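/- Let $\mathbb{T}$ be the group of complex numbers of modulus one. A subgroup $N$ of an Abelian topological group $G$ is called $h$-embedded in $G$ if every (not necessarily continuous) group homomorphism $N\to\mathbb{T}$ extends to a continuous homomorphism $G\to\mathbb{T}$. The group $G$ has property $\sharp h$ if every countable subgroup of $G$ is $h$-embedded in $G$. The group $G$ is totally bounded if for every neighbourhood $U$ of the identity, $G$ is covered by finitely many translates of $U$. Lemma. If $G$ is a totally bounded Abelian topological group with property $\sharp h$, then $G$ has no infinite compact subsets. -/

import Mathlib

/-- A subgroup `H` of an (Abelian) topological group `G` is `h`-embedded if every homomorphism of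
`H`, continuous or not, to the unit circle extends to a continuous homomorphism of `G` to the
unit circle. -/
def IsHEmbedded {G : Type*} [CommGroup G] [TopologicalSpace G] (H : Subgroup G) : Prop :=
  ∀ χ : H →* Circle, ∃ ψ : G →ₜ* Circle, ∀ x : H, ψ (x : G) = χ x

/-- Property `♯h`: every countable (finite or countably infinite) subgroup is `h`-embedded. -/
def HasPropertySharpH (G : Type*) [CommGroup G] [TopologicalSpace G] : Prop :=
  ∀ H : Subgroup G, (H : Set G).Countable → IsHEmbedded H

/-- A topological group is totally bounded if it is so for its group uniformity, that is, if
finitely many translates of each neighbourhood of `1` cover it. -/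
def IsTotallyBoundedGroup (G : Type*) [CommGroup G] [TopologicalSpace G]
    [IsTopologicalGroup G] : Prop :=
  letI : UniformSpace G := IsTopologicalGroup.rightUniformSpace G
  TotallyBounded (Set.univ : Set G)

/-! Distinct points of an infinite compact `K` generate a countable subgroup `H`, closed by `♯h`, so
`K ∩ H` is compact. Countably many continuous characters separate its points, so some subsequence
converges to a point `c ∈ H`. As every character of `H` extends continuously, the quotients by `c`
tend to `1` under all characters of `H`. Integrating over the compact dual of discrete `H` shows
that such a sequence must take the value `1`, which distinctness excludes on a tail. -/

/-- The characters of a discrete Abelian group into the circle separate points. -/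
theorem exists_monoidHom_circle_apply_ne_one {A : Type*} [CommGroup A] {a : A} (ha : a ≠ 1) :
    ∃ χ : A →* Circle, χ a ≠ 1 := by
  obtain ⟨c, hc⟩ := CharacterModule.exists_character_apply_ne_zero_of_ne_zero
    (A := Additive A) (a := Additive.ofMul a) ha
  -- `c` has values in `ℚ/ℤ`, which embeds in `ℝ/ℤ` and hence in the circle.
  let e : ℚ →+ AddCircle (1 : ℝ) :=
    (QuotientAddGroup.mk' (AddSubgroup.zmultiples (1 : ℝ))).comp (Rat.castHom ℝ).toAddMonoidHom
  have he : ∀ q : ℚ, e q = ((q : ℝ) : AddCircle (1 : ℝ)) := fun _ ↦ rfl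
  have hker : AddSubgroup.zmultiples (1 : ℚ) ≤ e.ker := by
    rw [AddSubgroup.zmultiples_le, AddMonoidHom.mem_ker, he]
    simp
  let f : AddCircle (1 : ℚ) →+ AddCircle (1 : ℝ) := QuotientAddGroup.lift _ e hker
  have hf : ∀ x, f x = 0 → x = 0 := by
    intro x
    induction x using QuotientAddGroup.induction_on with
    | H q =>
      intro h
      have h' : ((q : ℝ) : AddCircle (1 : ℝ)) = 0 := h
      obtain ⟨n, hn⟩ := (AddCircle.coe_eq_zero_iff (1 : ℝ)).1 h'
      refine (AddCircle.coe_eq_zero_iff (1 : ℚ)).2 ⟨n, ?_⟩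
      simp only [zsmul_eq_mul, mul_one] at hn ⊢
      exact_mod_cast hn
  refine ⟨⟨⟨fun x ↦ AddCircle.toCircle (f (c (Additive.ofMul x))), ?_⟩, ?_⟩, ?_⟩
  · rw [ofMul_one, map_zero, map_zero, AddCircle.toCircle_zero]
  · intro x y
    change AddCircle.toCircle (f (c (Additive.ofMul (x * y)))) = _
    rw [ofMul_mul, map_add, map_add, AddCircle.toCircle_add]
  · intro h
    change AddCircle.toCircle (f (c (Additive.ofMul a))) = 1 at h
    rw [← AddCircle.toCircle_zero] at h
    exact hc (hf _ (AddCircle.injective_toCircle one_ne_zero h))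

/-- The subgroups of an Abelian group are separated from outside points by characters. -/
theorem exists_monoidHom_circle_of_notMem {A : Type*} [CommGroup A] {B : Subgroup A} {a : A}
    (ha : a ∉ B) : ∃ χ : A →* Circle, (∀ b ∈ B, χ b = 1) ∧ χ a ≠ 1 := by
  obtain ⟨χ, hχ⟩ := exists_monoidHom_circle_apply_ne_one (A := A ⧸ B) (a := (a : A ⧸ B))
    (by rwa [Ne, QuotientGroup.eq_one_iff])
  refine ⟨χ.comp (QuotientGroup.mk' B), fun b hb ↦ ?_, hχ⟩
  have : (b : A ⧸ B) = 1 := (QuotientGroup.eq_one_iff b).2 hb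
  simp [this]

open MeasureTheory Filter Topology in
/-- A sequence in an Abelian group that tends to `1` in the Bohr topology of the discrete group
takes the value `1`. -/
theorem exists_eq_one_of_tendsto_monoidHom_circle {A : Type*} [CommGroup A] (u : ℕ → A)
    (hu : ∀ χ : A →* Circle, Tendsto (fun n ↦ χ (u n)) atTop (𝓝 1)) : ∃ n, u n = 1 := by
  by_contra! hne
  -- With `A` discrete, the dual consists of all characters and is compact.
  let : TopologicalSpace A := ⊥
  have : DiscreteTopology A := ⟨rfl⟩
  let : MeasurableSpace (PontryaginDual A) := borel _
  have : BorelSpace (PontryaginDual A) := ⟨rfl⟩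
  let μ : Measure (PontryaginDual A) := Measure.haarMeasure ⊤
  have : IsProbabilityMeasure μ := ⟨Measure.haarMeasure_self⟩
  have hcont : ∀ a : A, Continuous fun χ : PontryaginDual A ↦ ((χ a : Circle) : ℂ) := fun a ↦
    continuous_subtype_val.comp (ContinuousEvalConst.continuous_eval_const (F := A →ₜ* Circle) a)
  have hzero : ∀ n, ∫ χ : PontryaginDual A, ((χ (u n) : Circle) : ℂ) ∂μ = 0 := by
    intro n
    obtain ⟨χ₀, hχ₀⟩ := exists_monoidHom_circle_apply_ne_one (hne n)
    let ψ : PontryaginDual A := (⟨χ₀, continuous_of_discreteTopology⟩ : A →ₜ* Circle)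
    -- Translating by `ψ` multiplies the integral by `χ₀ (u n) ≠ 1`, so it vanishes.
    have h := integral_mul_left_eq_self (μ := μ)
      (fun χ : PontryaginDual A ↦ ((χ (u n) : Circle) : ℂ)) ψ
    have hmul : ∀ χ : PontryaginDual A,
        (((ψ * χ) (u n) : Circle) : ℂ) = (χ₀ (u n) : ℂ) * (χ (u n) : ℂ) := fun χ ↦
      Circle.coe_mul _ _
    simp_rw [hmul] at h
    rw [integral_const_mul] at h
    by_contra h0
    exact hχ₀ (Circle.ext (by simpa using (mul_eq_right₀ h0).1 h))
  have hlim := tendsto_integral_of_dominated_convergence (μ := μ)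
    (F := fun n (χ : PontryaginDual A) ↦ ((χ (u n) : Circle) : ℂ)) (f := fun _ ↦ (1 : ℂ))
    (fun _ ↦ (1 : ℝ)) (fun n ↦ (hcont (u n)).aestronglyMeasurable) (integrable_const _)
    (fun n ↦ .of_forall fun χ ↦ (Circle.norm_coe _).le)
    (.of_forall fun χ ↦
      (continuous_subtype_val.tendsto (1 : Circle)).comp (hu (χ : A →* Circle)))
  simp only [hzero, integral_const, probReal_univ, one_smul] at hlim
  exact zero_ne_one (tendsto_nhds_unique tendsto_const_nhds hlim)

section SharpH

variable {G : Type*} [CommGroup G] [TopologicalSpace G]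

/-- In a group with property `♯h`, every countable subgroup is closed. -/
theorem HasPropertySharpH.isClosed (hG : HasPropertySharpH G) {H : Subgroup G}
    (hH : (H : Set G).Countable) : IsClosed (H : Set G) := by
  refine isClosed_of_closure_subset fun g hg ↦ ?_
  by_contra hgH
  let L : Subgroup G := H ⊔ Subgroup.zpowers g
  have hL : (L : Set G).Countable := by
    rw [Subgroup.mul_normal]
    exact Set.Countable.image2 hH (Set.countable_range fun n : ℤ ↦ g ^ n) _
  have hgL : g ∈ L := (le_sup_right : _ ≤ L) (Subgroup.mem_zpowers g)
  obtain ⟨χ, hχ, hχg⟩ := exists_monoidHom_circle_of_notMem (B := H.subgroupOf L)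
    (a := (⟨g, hgL⟩ : L)) (by simpa [Subgroup.mem_subgroupOf] using hgH)
  obtain ⟨ψ, hψ⟩ := hG L hL χ
  have hmaps : (H : Set G) ⊆ ψ ⁻¹' {1} := fun x hx ↦ by
    have hxL : x ∈ L := (le_sup_left : _ ≤ L) hx
    have := hψ ⟨x, hxL⟩
    rw [hχ ⟨x, hxL⟩ (Subgroup.mem_subgroupOf.2 hx)] at this
    exact this
  have h1 : ψ g = 1 :=
    closure_minimal hmaps (isClosed_singleton.preimage ψ.continuous_toFun) hg
  exact hχg ((hψ ⟨g, hgL⟩).symm.trans h1)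

/-- In a group with property `♯h`, continuous characters separate the points. -/
theorem HasPropertySharpH.exists_apply_ne_one (hG : HasPropertySharpH G) {g : G} (hg : g ≠ 1) :
    ∃ ψ : G →ₜ* Circle, ψ g ≠ 1 := by
  let L := Subgroup.zpowers g
  obtain ⟨χ, hχ⟩ := exists_monoidHom_circle_apply_ne_one
    (a := (⟨g, Subgroup.mem_zpowers g⟩ : L)) (by simpa [Subtype.ext_iff] using hg)
  obtain ⟨ψ, hψ⟩ := hG L (Set.countable_range fun n : ℤ ↦ g ^ n) χ
  exact ⟨ψ, fun h ↦ hχ ((hψ ⟨g, Subgroup.mem_zpowers g⟩).symm.trans h)⟩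

open Filter Topology in
/-- In a group with property `♯h`, a sequence of distinct points in a compact subset of a
countable subgroup has a subsequence that converges in that subset. -/
theorem HasPropertySharpH.exists_tendsto_subseq (hG : HasPropertySharpH G) {H : Subgroup G}
    (hH : (H : Set G).Countable) {C : Set G} (hC : IsCompact C) (hCH : C ⊆ H) (y : ℕ → G)
    (hy : ∀ n, y n ∈ C) :
    ∃ c ∈ C, ∃ φ : ℕ → ℕ, StrictMono φ ∧ Tendsto (y ∘ φ) atTop (𝓝 c) := by
  have : Countable H := hH
  have : CompactSpace C := isCompact_iff_compactSpace.1 hC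
  choose! ψ hψ using fun (g : G) (hg : g ≠ 1) ↦ hG.exists_apply_ne_one hg
  -- Quotients of points of `C` lie in `H`, so the characters `ψ h` embed `C` in a countable power
  -- of the circle.
  let f : C → H → Circle := fun c h ↦ ψ h c
  have hf : Continuous f := continuous_pi fun h ↦
    (ψ h).continuous_toFun.comp continuous_subtype_val
  have hinj : Function.Injective f := by
    intro a b hab
    by_contra hne
    have hq : (a : G) / b ≠ 1 := by rwa [Ne, div_eq_one, Subtype.coe_inj]
    have hmem : (a : G) / b ∈ H := H.div_mem (hCH a.2) (hCH b.2)
    refine hψ _ hq ?_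
    rw [map_div, div_eq_one]
    exact congrFun hab ⟨_, hmem⟩
  have hemb := hf.isClosedEmbedding hinj
  have := hemb.isEmbedding.isInducing.firstCountableTopology
  obtain ⟨c, φ, hφ, hlim⟩ := CompactSpace.tendsto_subseq fun n ↦ (⟨y n, hy n⟩ : C)
  exact ⟨c, c.2, φ, hφ, (continuous_subtype_val.tendsto c).comp hlim⟩

open Filter Topology in
/-- A group with property `♯h` has no infinite compact subsets. -/
theorem HasPropertySharpH.finite_of_isCompact (hG : HasPropertySharpH G) {K : Set G}
    (hK : IsCompact K) : K.Finite := by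
  by_contra hinf
  let y : ℕ ↪ K := Set.Infinite.natEmbedding K hinf
  let H : Subgroup G := (FreeGroup.lift fun n ↦ (y n : G)).range
  have hH : (H : Set G).Countable := Set.countable_range _
  have hyH : ∀ n, (y n : G) ∈ H := fun n ↦ ⟨FreeGroup.of n, by simp⟩
  obtain ⟨c, hc, φ, hφ, hlim⟩ := hG.exists_tendsto_subseq hH
    (hK.inter_right (hG.isClosed hH)) Set.inter_subset_right (fun n ↦ (y n : G))
    fun n ↦ ⟨(y n).2, hyH n⟩
  -- the subsequence takes the value `c` at most once, so a tail of it avoids `c`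
  obtain ⟨N, hN⟩ : ∃ N, ∀ n, (y (φ (n + N)) : G) ≠ c := by
    by_cases h : ∃ m, (y (φ m) : G) = c
    · obtain ⟨m, hm⟩ := h
      refine ⟨m + 1, fun n hn ↦ ?_⟩
      have := hφ.injective (y.injective (Subtype.ext (hn.trans hm.symm)))
      omega
    · exact ⟨0, fun n hn ↦ h ⟨_, hn⟩⟩
  obtain ⟨n, hn⟩ := exists_eq_one_of_tendsto_monoidHom_circle
    (fun n ↦ (⟨y (φ (n + N)), hyH _⟩ / ⟨c, hc.2⟩ : H)) fun χ ↦ by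
      obtain ⟨ψ, hψ⟩ := hG H hH χ
      have h1 : Tendsto (fun n ↦ ψ (y (φ (n + N)) : G)) atTop (𝓝 (ψ c)) :=
        ((ψ.continuous_toFun.tendsto c).comp hlim).comp (tendsto_add_atTop_nat N)
      have h2 := h1.div' (tendsto_const_nhds (x := ψ c))
      rw [div_self'] at h2
      refine h2.congr fun n ↦ ?_
      rw [map_div, ← hψ, ← hψ]
  exact hN n (congrArg Subtype.val (div_eq_one.1 hn))

end SharpH

theorem mainTheorem7 (G : Type*) [CommGroup G] [TopologicalSpace G] [IsTopologicalGroup G]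
    (hG : IsTotallyBoundedGroup G) (hsharp : HasPropertySharpH G) :
    ¬ ∃ K : Set G, IsCompact K ∧ K.Infinite := by
  rintro ⟨K, hK, hinf⟩
  exact hinf (hsharp.finite_of_isCompact hK)
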